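/- For $0<\tau\le L$ and a convex set $\mathcal B\subseteq\mathbb R^n$ with non-empty interior, let $\mathcal F_{\tau,L,\mathcal B}$ be the class of differentiable functions $f$ on $\mathcal B$ that satisfy $f(y)\ge f(x)+\langle\nabla f(x),y-x\rangle+\frac{\tau}{2}\|x-y\|^2$ and $\|\nabla f(x)-\nabla f(y)\|\le L\|x-y\|$ for all $x,y\in\mathcal B$ and attain their minimum over $\mathcal B$ at a point $x_f^*\in\mathcal B$. For $\kappa\ge 1$, $\mu>0$ and $0<\delta_0\le\frac12$, a comparison oracle for $f$ with parameters $(\kappa,\mu,\delta_0)$ answers each query $(x,y)\in\mathcal B\times\mathcal B$ by a random sign $C_f(x,y)\in\{-1,+1\}$, which given $(x,y)$ is independent of the past, such that for all $x,y\in\mathcal B$ $$\mathbb P\bigl(C_f(x,y)=\operatorname{sign}\{f(y)-f(x)\}\bigr)\ \ge\ \tfrac12+\min\bigl\{\delta_0,\ \mu|f(y)-f(x)|^{\kappa-1}\bigr\},$$ where $|\cdot|^{0}=1$ and $\operatorname{sign}(0)$ is fixed to be one of $\pm1$ (the result holds for either choice). For an integer $T$ let $$R_T(\mathcal B)=\inf_{\widehat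 x_T}\ \sup_{f,\,C_f}\ \mathbb E\bigl[f(\widehat x_T)-f(x_f^*)\bigr],$$ where the infimum is over all estimators $\widehat x_T\in\mathcal B$ that use at most $T$ adaptively chosen, possibly randomized, queries to the oracle, and the supremum is over all $f\in\mathcal F_{\tau,L,\mathcal B}$ and all comparison oracles $C_f$ for $f$ with parameters $(\kappa,\mu,\delta_0)$. Theorem. Let $\kappa,\mu,\delta_0,\tau,L$ be as above and $r>0$. (i) If $\kappa=1$, there are constants $c_1,c_2>0$, depending only on $\mu,\delta_0,\tau,L,r$, such that for every $n\ge 8$, every convex $\mathcal B\subseteq\mathbb R^n$ that contains a ball of radius $r$, and all sufficiently large $T$ (depending on $n$, $\mathcal B$ and the parameters), $R_T(\mathcal B)\ge c_1\exp\{-c_2T/n\}$. (ii) If $\kappa>1$ and $\tau<L$, there is a constant $c_3>0$, depending only on $\kappa,\mu,\delta_0,\tau,L,r$, such that for every $n\ge 8$, every convex $\mathcal B\subseteq\mathbb R^n$ that contains a ball of radius $r$, and all sufficiently large $T$ (depending on $n$, $\mathcal B$ and the parameters), $R_T(\mathcal B)\ge c_3\left(\frac nT\right)^{\frac1{2(\kappa-1)}}$.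 -/

import Mathlib

open MeasureTheory ProbabilityTheory
open scoped ENNReal

noncomputable section

/-- `f` belongs to the class of `τ`-strongly convex functions on `B` with `L`-Lipschitz gradient
that attain their minimum in `B`. Only the restriction of `f` to `B` matters; `g` is the gradient
of `f` relative to `B` (which is unique when `B` is convex with non-empty interior). -/
def IsStronglyConvexSmooth {n : ℕ} (τ L : ℝ) (B : Set (EuclideanSpace ℝ (Fin n)))
    (f : EuclideanSpace ℝ (Fin n) → ℝ) : Prop :=
  ∃ g : EuclideanSpace ℝ (Fin n) → EuclideanSpace ℝ (Fin n),
    (∀ x ∈ B, HasGradientWithinAt f (g x) B x) ∧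
    (∀ x ∈ B, ∀ y ∈ B, f x + inner ℝ (g x) (y - x) + τ / 2 * ‖x - y‖ ^ 2 ≤ f y) ∧
    (∀ x ∈ B, ∀ y ∈ B, ‖g x - g y‖ ≤ L * ‖x - y‖) ∧
    (∃ x ∈ B, IsMinOn f B x)

/-- The two-valued sign of a real number: `true` stands for `+1` and `false` for `-1`. Since the
oracle is binary, the sign of `0` has to be one of the two values; `s₀` is the one chosen. -/
def boolSign (s₀ : Bool) (t : ℝ) : Bool :=
  if 0 < t then true else if t < 0 then false else s₀

/-- The Markov kernel `C` (the law of the binary answer to the query `(x, y)`) is a comparison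
oracle for `f` with parameters `(κ, μ, δ₀)`. For `κ = 1` the power is `1`, also at `f x = f y`. -/
def IsComparisonOracle {n : ℕ} (s₀ : Bool) (κ μ δ₀ : ℝ) {B : Set (EuclideanSpace ℝ (Fin n))}
    (f : EuclideanSpace ℝ (Fin n) → ℝ) (C : Kernel (B × B) Bool) : Prop :=
  IsMarkovKernel C ∧
    ∀ x y : B, 1 / 2 + min δ₀ (μ * |f y - f x| ^ (κ - 1)) ≤
      (C (x, y)).real {boolSign s₀ (f y - f x)}

/-- The transcript of `k` rounds: for each round the pair that was queried and the answer. -/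
abbrev Transcript {n : ℕ} (B : Set (EuclideanSpace ℝ (Fin n))) (k : ℕ) : Type :=
  Fin k → (B × B) × Bool

/-- An estimator that makes `T` adaptive and possibly randomized comparison queries:
`query k` is the conditional law of the next query given the transcript of the first `k` rounds
(only `k < T` is used), `estimate` is the conditional law of the output given the full transcript.
A procedure that wants fewer than `T` queries is included: it repeats a query and ignores the
answers. -/
structure Estimator {n : ℕ} (B : Set (EuclideanSpace ℝ (Fin n))) (T : ℕ) where
  query : (k : ℕ) → Kernel (Transcript B k) (B × B)
  query_markov : ∀ k, IsMarkovKernel (query k)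
  estimate : Kernel (Transcript B T) B
  estimate_markov : IsMarkovKernel estimate

/-- The law of one round given the past: a query is drawn, then the oracle's answer is drawn
from `C` at that query, conditionally independently of the past. -/
def Estimator.round {n : ℕ} {B : Set (EuclideanSpace ℝ (Fin n))} {T : ℕ} (A : Estimator B T)
    (C : Kernel (B × B) Bool) (k : ℕ) : Kernel (Transcript B k) ((B × B) × Bool) :=
  (A.query k) ⊗ₖ (Kernel.prodMkLeft (Transcript B k) C)

/-- The law of the transcript of the first `k` rounds of `A` played against the oracle `C`. -/
def Estimator.law {n : ℕ} {B : Set (EuclideanSpace ℝ (Fin n))} {T : ℕ} (A : Estimator B T)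
    (C : Kernel (B × B) Bool) : (k : ℕ) → Measure (Transcript B k)
  | 0 => Measure.dirac Fin.elim0
  | k + 1 => ((A.law C k) ⊗ₘ (A.round C k)).map
      (fun p => (Fin.snoc (α := fun _ => (B × B) × Bool) p.1 p.2 : Transcript B (k + 1)))

/-- The law of the point returned by `A` after its `T` queries to the oracle `C`. -/
def Estimator.outputLaw {n : ℕ} {B : Set (EuclideanSpace ℝ (Fin n))} {T : ℕ}
    (A : Estimator B T) (C : Kernel (B × B) Bool) : Measure B :=
  (A.law C T).bind A.estimate

/-- The expected optimization error `𝔼[f(x̂) - f(x⋆)]` of `A`, for a minimizer `xs` of `f`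
on `B` (the integrand is non-negative, so the expectation always exists in `[0, ∞]`). -/
def Estimator.expectedError {n : ℕ} {B : Set (EuclideanSpace ℝ (Fin n))} {T : ℕ}
    (A : Estimator B T) (C : Kernel (B × B) Bool) (f : EuclideanSpace ℝ (Fin n) → ℝ)
    (xs : EuclideanSpace ℝ (Fin n)) : ℝ≥0∞ :=
  ∫⁻ x : B, ENNReal.ofReal (f x - f xs) ∂(A.outputLaw C)

/-- The minimax risk: infimum over all estimators with `T` queries, supremum over all `f` in the
class (with minimizer `xs`) and all comparison oracles for `f` with the given parameters. -/
def comparisonMinimaxRisk {n : ℕ} (s₀ : Bool) (κ μ δ₀ τ L : ℝ) (B : Set (EuclideanSpace ℝ (Fin n)))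
    (T : ℕ) : ℝ≥0∞ :=
  ⨅ A : Estimator B T,
    ⨆ (f : EuclideanSpace ℝ (Fin n) → ℝ) (_ : IsStronglyConvexSmooth τ L B f)
      (xs : EuclideanSpace ℝ (Fin n)) (_ : xs ∈ B ∧ IsMinOn f B xs)
      (C : Kernel (B × B) Bool) (_ : IsComparisonOracle s₀ κ μ δ₀ f C),
      A.expectedError C f xs

end

/-! Put a hard function `f` at every possible minimizer `v` in a ball of radius `R`, and compare all
their oracles with one reference oracle `Q` that does not know `v`. If one answer of each oracle has
density of second moment at most `K` against `Q`, then `T` adaptive rounds have at most `K ^ T`, and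
Cauchy-Schwarz gives `P s ^ 2 ≤ K ^ T * Q s` for every event. Under `Q` the output is blind to `v`,
so by averaging some `v` has a `δ`-ball of `Q`-probability at most `(δ / R) ^ n`. If `K ^ T * (δ /
R) ^ n ≤ 1 / 4`, the estimator misses that `v` by `δ` with probability at least one half, and
quadratic growth costs `τ / 4 * δ ^ 2` (`le_comparisonMinimaxRisk`).

For `κ = 1`, plain quadratics with exact answers against a fair coin give `K = 2`, hence `δ` of
order `2 ^ (-T / n)`.

For `κ > 1`, a fixed quadratic gets a bounded sinusoidal perturbation of size `h ^ 2` that moves its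
minimizer by order `h`. Large increments keep their sign, so their exact answers reveal nothing
about `v`; small ones need only a bias `η` of order `h ^ (2 * (κ - 1))`. Then `K = 1 + 4 * η ^ 2`,
and `h` is tuned to `4 * η ^ 2 = n / T`. The risk is of order `h ^ 2`. -/

noncomputable section

/-! ### Comparison of expectations through second moments -/

/-- For a law `P` with a density with respect to `Q`, this bounds the second moment of the density
by `K`. -/
def SecondMomentBound {α : Type*} [MeasurableSpace α] (P Q : Measure α) (K : ℝ≥0∞) : Prop :=
  ∀ g : α → ℝ≥0∞, Measurable g → (∫⁻ x, g x ∂P) ^ 2 ≤ K * ∫⁻ x, g x ^ 2 ∂Q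

namespace SecondMomentBound

variable {α β : Type*} [MeasurableSpace α] [MeasurableSpace β]

theorem refl (P : Measure α) [IsProbabilityMeasure P] : SecondMomentBound P P 1 := by
  intro g hg
  have h := ENNReal.lintegral_mul_le_Lp_mul_Lq P Real.HolderConjugate.two_two
    hg.aemeasurable (aemeasurable_const (b := (1 : ℝ≥0∞)))
  simp only [Pi.mul_apply, mul_one, ENNReal.one_rpow, lintegral_const, measure_univ] at h
  calc (∫⁻ x, g x ∂P) ^ 2 ≤ ((∫⁻ x, g x ^ (2 : ℝ) ∂P) ^ (1 / 2 : ℝ)) ^ 2 := by gcongr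
    _ = 1 * ∫⁻ x, g x ^ 2 ∂P := by
      rw [← ENNReal.rpow_natCast, ← ENNReal.rpow_mul]
      norm_num

/-- Cauchy-Schwarz in stages: `h₁` is applied to the inner integral, then `h₂` pointwise. Since `K₂`
is uniform in the past, adaptivity is harmless. -/
theorem compProd {P Q : Measure α} [SFinite P] [SFinite Q] {κ η : Kernel α β}
    [IsSFiniteKernel κ] [IsSFiniteKernel η] {K₁ K₂ : ℝ≥0∞} (h₁ : SecondMomentBound P Q K₁)
    (h₂ : ∀ a, SecondMomentBound (κ a) (η a) K₂) :
    SecondMomentBound (P ⊗ₘ κ) (Q ⊗ₘ η) (K₁ * K₂) := by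
  intro g hg
  rw [Measure.lintegral_compProd hg, Measure.lintegral_compProd (hg.pow_const 2)]
  calc (∫⁻ a, ∫⁻ b, g (a, b) ∂κ a ∂P) ^ 2
      ≤ K₁ * ∫⁻ a, (∫⁻ b, g (a, b) ∂κ a) ^ 2 ∂Q := h₁ _ hg.lintegral_kernel_prod_right'
    _ ≤ K₁ * ∫⁻ a, K₂ * ∫⁻ b, g (a, b) ^ 2 ∂η a ∂Q := by
      gcongr with a
      exact h₂ a _ (hg.comp measurable_prodMk_left)
    _ = K₁ * K₂ * ∫⁻ a, ∫⁻ b, g (a, b) ^ 2 ∂η a ∂Q := by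
      rw [lintegral_const_mul _ (hg.pow_const 2).lintegral_kernel_prod_right', mul_assoc]

theorem map {P Q : Measure α} {K : ℝ≥0∞} (h : SecondMomentBound P Q K) {u : α → β}
    (hu : Measurable u) : SecondMomentBound (P.map u) (Q.map u) K := by
  intro g hg
  rw [lintegral_map hg hu, lintegral_map (hg.pow_const 2) hu]
  exact h _ (hg.comp hu)

theorem bind {P Q : Measure α} {K : ℝ≥0∞} (h : SecondMomentBound P Q K) (κ : Kernel α β)
    [IsMarkovKernel κ] : SecondMomentBound (P.bind κ) (Q.bind κ) K := by
  intro g hg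
  rw [Measure.lintegral_bind κ.aemeasurable hg.aemeasurable,
    Measure.lintegral_bind κ.aemeasurable (hg.pow_const 2).aemeasurable]
  refine (h _ hg.lintegral_kernel).trans ?_
  gcongr with a
  simpa using refl (κ a) g hg

theorem measure_sq_le {P Q : Measure α} {K : ℝ≥0∞} (h : SecondMomentBound P Q K) {s : Set α}
    (hs : MeasurableSet s) : P s ^ 2 ≤ K * Q s := by
  have := h (s.indicator 1) (measurable_one.indicator hs)
  have h2 : (fun x => s.indicator (1 : α → ℝ≥0∞) x ^ 2) = s.indicator 1 := by
    ext x
    by_cases hx : x ∈ s <;> simp [hx]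
  rwa [h2, lintegral_indicator_one hs, lintegral_indicator_one hs] at this

end SecondMomentBound

/-! ### Change of measure along an adaptive transcript -/

section Estimator

variable {n T : ℕ} {B : Set (EuclideanSpace ℝ (Fin n))}

theorem Estimator.round_isMarkovKernel (A : Estimator B T) (C : Kernel (B × B) Bool)
    [IsMarkovKernel C] (k : ℕ) : IsMarkovKernel (A.round C k) := by
  have := A.query_markov k
  unfold Estimator.round
  infer_instance

theorem measurable_transcript_snoc (k : ℕ) : Measurable
    (fun p : Transcript B k × ((B × B) × Bool) =>
      (Fin.snoc (α := fun _ => (B × B) × Bool) p.1 p.2 : Transcript B (k + 1))) := by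
  rw [measurable_pi_iff]
  intro i
  refine Fin.lastCases ?_ (fun j => ?_) i
  · simpa using measurable_snd
  · simp only [Fin.snoc_castSucc]
    exact (measurable_pi_apply j).comp measurable_fst

theorem Estimator.law_isProbabilityMeasure (A : Estimator B T) (C : Kernel (B × B) Bool)
    [IsMarkovKernel C] (k : ℕ) : IsProbabilityMeasure (A.law C k) := by
  induction k with
  | zero => unfold Estimator.law; infer_instance
  | succ k ih =>
    have := A.round_isMarkovKernel C k
    exact Measure.isProbabilityMeasure_map (measurable_transcript_snoc k).aemeasurable

theorem Estimator.outputLaw_isProbabilityMeasure (A : Estimator B T) (C : Kernel (B × B) Bool)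
    [IsMarkovKernel C] : IsProbabilityMeasure (A.outputLaw C) := by
  have := A.law_isProbabilityMeasure C T
  have := A.estimate_markov
  unfold Estimator.outputLaw
  infer_instance

/-- The query is drawn from the same kernel under both oracles and contributes a factor 1; only the
answer costs `K`. -/
theorem Estimator.secondMomentBound_round (A : Estimator B T) {C Q : Kernel (B × B) Bool}
    [IsMarkovKernel C] [IsMarkovKernel Q] {K : ℝ≥0∞}
    (h : ∀ z, SecondMomentBound (C z) (Q z) K) (k : ℕ) (p : Transcript B k) :
    SecondMomentBound (A.round C k p) (A.round Q k p) K := by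
  have := A.query_markov k
  unfold Estimator.round
  rw [Kernel.compProd_apply_eq_compProd_sectR, Kernel.compProd_apply_eq_compProd_sectR]
  have := (SecondMomentBound.refl (A.query k p)).compProd
    (κ := (Kernel.prodMkLeft (Transcript B k) C).sectR p)
    (η := (Kernel.prodMkLeft (Transcript B k) Q).sectR p) (K₂ := K)
    (fun z => by simpa [Kernel.sectR_apply, Kernel.prodMkLeft_apply] using h z)
  rwa [one_mul] at this

theorem Estimator.secondMomentBound_law (A : Estimator B T) {C Q : Kernel (B × B) Bool}
    [IsMarkovKernel C] [IsMarkovKernel Q] {K : ℝ≥0∞}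
    (h : ∀ z, SecondMomentBound (C z) (Q z) K) (k : ℕ) :
    SecondMomentBound (A.law C k) (A.law Q k) (K ^ k) := by
  induction k with
  | zero => simpa [Estimator.law] using SecondMomentBound.refl _
  | succ k ih =>
    have := A.round_isMarkovKernel C k
    have := A.round_isMarkovKernel Q k
    have := A.law_isProbabilityMeasure C k
    have := A.law_isProbabilityMeasure Q k
    rw [pow_succ]
    exact (ih.compProd (A.secondMomentBound_round h k)).map (measurable_transcript_snoc k)

theorem Estimator.secondMomentBound_outputLaw (A : Estimator B T) {C Q : Kernel (B × B) Bool}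
    [IsMarkovKernel C] [IsMarkovKernel Q] {K : ℝ≥0∞}
    (h : ∀ z, SecondMomentBound (C z) (Q z) K) :
    SecondMomentBound (A.outputLaw C) (A.outputLaw Q) (K ^ T) := by
  have := A.estimate_markov
  exact (A.secondMomentBound_law h T).bind A.estimate

end Estimator

/-! ### Reduction of the risk bound to a family of nearby oracles -/

/-- Some point of a ball of radius `R` has a `δ`-neighbourhood of probability at most
`(δ / R) ^ n`. -/
theorem exists_measure_ball_le {n : ℕ} (hn : 0 < n) {B : Set (EuclideanSpace ℝ (Fin n))}
    (P : Measure B) [IsProbabilityMeasure P] (x₀ : EuclideanSpace ℝ (Fin n)) {R δ : ℝ}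
    (hR : 0 < R) (hδ : 0 ≤ δ) :
    ∃ v ∈ Metric.ball x₀ R, P {x : B | dist (x : EuclideanSpace ℝ (Fin n)) v < δ} ≤
      ENNReal.ofReal ((δ / R) ^ n) := by
  have : Nonempty (Fin n) := ⟨⟨0, hn⟩⟩
  have : Nontrivial (EuclideanSpace ℝ (Fin n)) := inferInstance
  let E := EuclideanSpace ℝ (Fin n)
  set S : Set (E × B) := {p | dist (p.2 : E) p.1 < δ} with hS
  have hSm : MeasurableSet S :=
    measurableSet_lt (by fun_prop) measurable_const
  have hfr : Module.finrank ℝ E = n := by simp [E]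
  -- By Tonelli, this becomes the `P`-average of the volume of a `δ`-ball around `x`, which does not
  -- depend on `x`.
  have htotal : ∫⁻ v in Metric.ball x₀ R, P {x : B | dist (x : E) v < δ} ≤
      ENNReal.ofReal (δ ^ n) * volume (Metric.ball (0 : E) 1) := by
    calc ∫⁻ v in Metric.ball x₀ R, P {x : B | dist (x : E) v < δ}
        ≤ ∫⁻ v : E, P (Prod.mk v ⁻¹' S) := setLIntegral_le_lintegral _ _
      _ = ∫⁻ x : B, volume ((fun v : E => (v, x)) ⁻¹' S) ∂P := by
        rw [← Measure.prod_apply hSm, Measure.prod_apply_symm hSm]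
      _ = ∫⁻ x : B, ENNReal.ofReal (δ ^ n) * volume (Metric.ball (0 : E) 1) ∂P := by
        congr with x
        have : (fun v : E => (v, x)) ⁻¹' S = Metric.ball (x : E) δ := by
          ext v; simp [S, dist_comm]
        rw [this, Measure.addHaar_ball _ _ hδ, hfr]
      _ = _ := by simp
  by_contra! hcon
  have hlt : ∫⁻ v in Metric.ball x₀ R, ENNReal.ofReal ((δ / R) ^ n) <
      ∫⁻ v in Metric.ball x₀ R, P {x : B | dist (x : E) v < δ} := by
    refine setLIntegral_strict_mono Metric.isOpen_ball.measurableSet ?_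
      (measurable_measure_prodMk_left hSm) ?_ (Filter.Eventually.of_forall hcon)
    · exact (Metric.measure_ball_pos _ _ hR).ne'
    · rw [setLIntegral_const]
      exact ENNReal.mul_ne_top ENNReal.ofReal_ne_top measure_ball_lt_top.ne
  refine absurd (hlt.trans_le htotal) (not_lt.2 (le_of_eq ?_))
  rw [setLIntegral_const, Measure.addHaar_ball _ _ hR.le, hfr, ← mul_assoc,
    ← ENNReal.ofReal_mul (by positivity), div_pow, div_mul_cancel₀ _ (by positivity)]

/-- A minimax lower bound from a family of functions, indexed by their minimizers in a ball, whose
oracles are all close to one oracle `Q`. -/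
theorem le_comparisonMinimaxRisk {n : ℕ} (hn : 0 < n) (s₀ : Bool) {κ μ δ₀ τ L : ℝ} (hτ : 0 ≤ τ)
    {B : Set (EuclideanSpace ℝ (Fin n))} {T : ℕ} {x₀ : EuclideanSpace ℝ (Fin n)} {R δ K : ℝ}
    (hR : 0 < R) (hδ : 0 ≤ δ) (hK : 0 ≤ K) (hball : Metric.ball x₀ R ⊆ B)
    (Q : Kernel (B × B) Bool) [IsMarkovKernel Q]
    (h : ∀ v ∈ Metric.ball x₀ R, ∃ f : EuclideanSpace ℝ (Fin n) → ℝ,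
      IsStronglyConvexSmooth τ L B f ∧ (∀ x ∈ B, f v + τ / 2 * ‖x - v‖ ^ 2 ≤ f x) ∧
      ∃ C : Kernel (B × B) Bool, IsComparisonOracle s₀ κ μ δ₀ f C ∧
        ∀ z, SecondMomentBound (C z) (Q z) (ENNReal.ofReal K))
    (hKδ : K ^ T * (δ / R) ^ n ≤ 1 / 4) :
    ENNReal.ofReal (τ / 4 * δ ^ 2) ≤ comparisonMinimaxRisk s₀ κ μ δ₀ τ L B T := by
  refine le_iInf fun A => ?_
  have := A.outputLaw_isProbabilityMeasure Q
  -- `v` is chosen from the output law under `Q` alone, before `f` and `C`, so there is no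
  -- circularity.
  obtain ⟨v, hv, hQ⟩ := exists_measure_ball_le hn (A.outputLaw Q) x₀ hR hδ
  obtain ⟨f, hf, hmin, C, hC, hCQ⟩ := h v hv
  have := hC.1
  have := A.outputLaw_isProbabilityMeasure C
  have hvmin : v ∈ B ∧ IsMinOn f B v := by
    refine ⟨hball hv, fun x hx => (le_add_of_nonneg_right (by positivity)).trans (hmin x hx)⟩
  refine le_trans ?_ (le_iSup₂_of_le f hf (le_iSup₂_of_le v hvmin
    (le_iSup₂_of_le C hC le_rfl)))
  set s : Set B := {x : B | dist (x : EuclideanSpace ℝ (Fin n)) v < δ} with hs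
  have hsm : MeasurableSet s := measurableSet_lt (by fun_prop) measurable_const
  have hsq : A.outputLaw C s ^ 2 ≤ (2⁻¹) ^ 2 := by
    calc A.outputLaw C s ^ 2 ≤ ENNReal.ofReal K ^ T * A.outputLaw Q s :=
          (A.secondMomentBound_outputLaw hCQ).measure_sq_le hsm
      _ ≤ ENNReal.ofReal K ^ T * ENNReal.ofReal ((δ / R) ^ n) := by gcongr
      _ = ENNReal.ofReal (K ^ T * (δ / R) ^ n) := by
        rw [ENNReal.ofReal_mul (by positivity), ENNReal.ofReal_pow hK]
      _ ≤ ENNReal.ofReal ((2⁻¹) ^ 2) := ENNReal.ofReal_le_ofReal (by linarith)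
      _ = (2⁻¹) ^ 2 := by
        rw [ENNReal.ofReal_pow (by norm_num), ENNReal.ofReal_inv_of_pos (by norm_num)]
        simp
  have hP : A.outputLaw C s ≤ 2⁻¹ := (ENNReal.pow_le_pow_left_iff two_ne_zero).1 hsq
  have hPc : 2⁻¹ ≤ A.outputLaw C sᶜ := by
    rw [prob_compl_eq_one_sub hsm, ← ENNReal.one_sub_inv_two]
    exact tsub_le_tsub_left hP 1
  calc ENNReal.ofReal (τ / 4 * δ ^ 2) = ENNReal.ofReal (τ / 2 * δ ^ 2) * 2⁻¹ := by
        rw [show τ / 4 * δ ^ 2 = τ / 2 * δ ^ 2 * 2⁻¹ by ring, ENNReal.ofReal_mul (by positivity),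
          ENNReal.ofReal_inv_of_pos (by norm_num)]
        simp
    _ ≤ ENNReal.ofReal (τ / 2 * δ ^ 2) * A.outputLaw C sᶜ := by gcongr
    _ = ∫⁻ x in sᶜ, ENNReal.ofReal (τ / 2 * δ ^ 2) ∂(A.outputLaw C) := by
      rw [setLIntegral_const]
    _ ≤ ∫⁻ x in sᶜ, ENNReal.ofReal (f x - f v) ∂(A.outputLaw C) := by
      refine setLIntegral_mono' hsm.compl fun x hx => ENNReal.ofReal_le_ofReal ?_
      have h1 : δ ≤ ‖(x : EuclideanSpace ℝ (Fin n)) - v‖ := by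
        simpa [s, dist_eq_norm] using hx
      have h2 := hmin x x.2
      have h3 : δ ^ 2 ≤ ‖(x : EuclideanSpace ℝ (Fin n)) - v‖ ^ 2 := by gcongr
      nlinarith
    _ ≤ _ := setLIntegral_le_lintegral _ _

/-! ### Oracles with a prescribed bias -/

/-- The kernel that answers `s z` with probability `1 / 2 + e z`. -/
def biasedKernel {Z : Type*} [MeasurableSpace Z] (s : Z → Bool) (hs : Measurable s) (e : Z → ℝ)
    (he : Measurable e) : Kernel Z Bool where
  toFun z := ENNReal.ofReal (1 / 2 + e z) • Measure.dirac (s z) +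
    ENNReal.ofReal (1 / 2 - e z) • Measure.dirac (!(s z))
  measurable' := by
    refine Measure.measurable_of_measurable_coe _ fun t ht => ?_
    simp only [Measure.add_apply, Measure.smul_apply, smul_eq_mul]
    have h1 : Measurable fun z => Measure.dirac (s z) t :=
      (Measure.measurable_coe ht).comp (Measure.measurable_dirac.comp hs)
    have h2 : Measurable fun z => Measure.dirac (!(s z)) t :=
      (Measure.measurable_coe ht).comp
        (Measure.measurable_dirac.comp ((measurable_of_countable not).comp hs))
    fun_prop

section biasedKernel

variable {Z : Type*} [MeasurableSpace Z] {s s' : Z → Bool} {hs : Measurable s}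
  {hs' : Measurable s'} {e e' : Z → ℝ} {he : Measurable e} {he' : Measurable e'}

theorem biasedKernel_apply (z : Z) : biasedKernel s hs e he z =
    ENNReal.ofReal (1 / 2 + e z) • Measure.dirac (s z) +
      ENNReal.ofReal (1 / 2 - e z) • Measure.dirac (!(s z)) := rfl

theorem lintegral_biasedKernel (z : Z) (g : Bool → ℝ≥0∞) : ∫⁻ b, g b ∂(biasedKernel s hs e he z) =
    ENNReal.ofReal (1 / 2 + e z) * g (s z) + ENNReal.ofReal (1 / 2 - e z) * g (!(s z)) := by
  rw [biasedKernel_apply, lintegral_add_measure, lintegral_smul_measure, lintegral_smul_measure,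
    lintegral_dirac, lintegral_dirac, smul_eq_mul, smul_eq_mul]

theorem isMarkovKernel_biasedKernel (h : ∀ z, |e z| ≤ 1 / 2) :
    IsMarkovKernel (biasedKernel s hs e he) := by
  refine ⟨fun z => ⟨?_⟩⟩
  have := abs_le.1 (h z)
  have h1 := lintegral_biasedKernel (hs := hs) (he := he) z 1
  simp only [Pi.one_apply, lintegral_one, mul_one] at h1
  rw [h1, ← ENNReal.ofReal_add (by linarith) (by linarith)]
  norm_num

theorem biasedKernel_real_singleton (z : Z) (h : |e z| ≤ 1 / 2) :
    (biasedKernel s hs e he z).real {s z} = 1 / 2 + e z := by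
  have := abs_le.1 h
  rw [measureReal_def, biasedKernel_apply, Measure.add_apply, Measure.smul_apply,
    Measure.smul_apply]
  simp only [MeasurableSet.singleton, Measure.dirac_apply', Set.mem_singleton_iff,
    Set.indicator_of_mem, Pi.one_apply, smul_eq_mul, mul_one, Bool.not_eq_self, not_false_eq_true,
    Set.indicator_of_notMem, mul_zero, add_zero]
  rw [ENNReal.toReal_ofReal (by linarith)]

theorem biasedKernel_congr {z : Z} (hss : s z = s' z) (hee : e z = e' z) :
    biasedKernel s hs e he z = biasedKernel s' hs' e' he' z := by
  simp only [biasedKernel_apply, hss, hee]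

/-- Cauchy-Schwarz in the plane; infinite values, and zero weights against them, need separate care.
-/
theorem sq_weighted_add_le {p q : ℝ} (hp : 0 ≤ p) (hq : 0 ≤ q) (a b : ℝ≥0∞) :
    (ENNReal.ofReal p * a + ENNReal.ofReal q * b) ^ 2 ≤
      ENNReal.ofReal (p ^ 2 + q ^ 2) * (a ^ 2 + b ^ 2) := by
  rcases eq_or_lt_of_le (add_nonneg (sq_nonneg p) (sq_nonneg q)) with h | h
  · have h1 : p = 0 := by nlinarith [sq_nonneg q]
    have h2 : q = 0 := by nlinarith [sq_nonneg p]
    simp [h1, h2]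
  rcases eq_or_ne a ∞ with rfl | ha
  · simp [ENNReal.mul_top, h]
  rcases eq_or_ne b ∞ with rfl | hb
  · simp [ENNReal.mul_top, h]
  lift a to NNReal using ha
  lift b to NNReal using hb
  lift p to NNReal using hp
  lift q to NNReal using hq
  rw [← NNReal.coe_pow, ← NNReal.coe_pow, ← NNReal.coe_add]
  simp only [ENNReal.ofReal_coe_nnreal]
  norm_cast
  rw [← NNReal.coe_le_coe]
  push_cast
  nlinarith [sq_nonneg ((p : ℝ) * b - q * a)]

/-- A coin of bias `e` against a fair coin. -/
theorem secondMomentBound_biasedKernel (z : Z) (h : |e z| ≤ 1 / 2) (h' : e' z = 0) {η : ℝ}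
    (hη : e z ^ 2 ≤ η ^ 2) :
    SecondMomentBound (biasedKernel s hs e he z) (biasedKernel s' hs' e' he' z)
      (ENNReal.ofReal (1 + 4 * η ^ 2)) := by
  intro g _
  have := abs_le.1 h
  rw [lintegral_biasedKernel, lintegral_biasedKernel, h', add_zero, sub_zero, ← mul_add,
    ← mul_assoc, ← ENNReal.ofReal_mul (by positivity)]
  have hsum : g (s' z) ^ 2 + g (!(s' z)) ^ 2 = g (s z) ^ 2 + g (!(s z)) ^ 2 := by
    cases s z <;> cases s' z <;> simp [add_comm]
  rw [hsum]
  refine (sq_weighted_add_le (by linarith) (by linarith) _ _).trans ?_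
  gcongr
  nlinarith

end biasedKernel

theorem measurable_boolSign (s₀ : Bool) : Measurable (boolSign s₀) :=
  Measurable.ite measurableSet_Ioi measurable_const
    (Measurable.ite measurableSet_Iio measurable_const measurable_const)

/-- Strictness forces `t ≠ 0`, so both numbers have the same strict sign and `s₀` never enters. -/
theorem boolSign_eq_of_abs_sub_lt {s₀ : Bool} {s t : ℝ} (h : |s - t| < |t|) :
    boolSign s₀ s = boolSign s₀ t := by
  unfold boolSign
  rcases le_total 0 t with ht | ht
  · rw [abs_of_nonneg ht, abs_lt] at h
    rw [if_pos (by linarith), if_pos (by linarith)]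
  · rw [abs_of_nonpos ht, abs_lt] at h
    rw [if_neg (by linarith), if_pos (by linarith), if_neg (by linarith), if_pos (by linarith)]

/-! ### Quadratics with a small sinusoidal perturbation -/

theorem abs_sin_sub_self_le_sq (d : ℝ) : |Real.sin d - d| ≤ d ^ 2 := by
  have key : ∀ d : ℝ, 0 < d → |Real.sin d - d| ≤ d ^ 2 := by
    intro d hd
    rw [abs_of_nonpos (by linarith [Real.sin_lt hd])]
    -- The cubic Taylor error is below `d ^ 2` up to 6; beyond that, `d + 1 ≤ d ^ 2` suffices.
    rcases le_total d 6 with h | h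
    · nlinarith [Real.sin_gt_sub_cube hd, mul_nonneg (sq_nonneg d) (sub_nonneg.2 h)]
    · nlinarith [Real.neg_one_le_sin d]
  rcases lt_trichotomy d 0 with h | rfl | h
  · have := key (-d) (by linarith)
    rwa [Real.sin_neg, ← abs_neg, show -(-Real.sin d - -d) = Real.sin d - d by ring, neg_sq] at this
  · simp
  · exact key d h

theorem abs_sin_sub_sin_sub_cos_mul_le (s t : ℝ) :
    |Real.sin t - Real.sin s - Real.cos s * (t - s)| ≤ 2 * (t - s) ^ 2 := by
  obtain ⟨d, rfl⟩ : ∃ d, t = s + d := ⟨t - s, by ring⟩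
  have h1 := abs_sin_sub_self_le_sq d
  have h2 : |Real.cos d - 1| ≤ d ^ 2 / 2 := by
    rw [abs_of_nonpos (by linarith [Real.cos_le_one d])]
    linarith [Real.one_sub_sq_div_two_le_cos (x := d)]
  rw [Real.sin_add, add_sub_cancel_left]
  calc |Real.sin s * Real.cos d + Real.cos s * Real.sin d - Real.sin s - Real.cos s * d|
      = |Real.sin s * (Real.cos d - 1) + Real.cos s * (Real.sin d - d)| := by ring_nf
    _ ≤ |Real.sin s * (Real.cos d - 1)| + |Real.cos s * (Real.sin d - d)| := abs_add_le _ _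
    _ ≤ 1 * (d ^ 2 / 2) + 1 * d ^ 2 := by
      rw [abs_mul, abs_mul]
      gcongr
      · exact Real.abs_sin_le_one s
      · exact Real.abs_cos_le_one s
    _ ≤ 2 * d ^ 2 := by nlinarith [sq_nonneg d]

section sinQuadratic

variable {E : Type*} [NormedAddCommGroup E] [InnerProductSpace ℝ E]

/-- The phase of the perturbation in `sinQuadratic`. -/
def sinPhase (h : ℝ) (x₀ w x : E) : ℝ := inner ℝ w (h⁻¹ • (x - x₀) - w)

/-- A quadratic centred at `x₀` with a bounded perturbation that moves its minimizer to
`x₀ + h • w`. -/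
def sinQuadratic (a h : ℝ) (x₀ w x : E) : ℝ :=
  a / 2 * ‖x - x₀‖ ^ 2 - a * h ^ 2 * Real.sin (sinPhase h x₀ w x)

/-- The gradient of `sinQuadratic`. -/
def sinQuadraticGrad (a h : ℝ) (x₀ w x : E) : E :=
  a • (x - x₀) - (a * h * Real.cos (sinPhase h x₀ w x)) • w

theorem sinPhase_sub (h : ℝ) (x₀ w x y : E) :
    sinPhase h x₀ w y - sinPhase h x₀ w x = h⁻¹ * inner ℝ w (y - x) := by
  rw [sinPhase, sinPhase, ← inner_sub_right, ← inner_smul_right]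
  congr 1
  module

theorem sinPhase_sub_sq_le (h : ℝ) (x₀ w x y : E) :
    (sinPhase h x₀ w y - sinPhase h x₀ w x) ^ 2 ≤ h⁻¹ ^ 2 * (‖w‖ ^ 2 * ‖y - x‖ ^ 2) := by
  rw [sinPhase_sub, mul_pow, ← mul_pow ‖w‖]
  exact mul_le_mul_of_nonneg_left
    (sq_le_sq.2 ((abs_real_inner_le_norm _ _).trans (le_abs_self _))) (by positivity)

theorem continuous_sinQuadratic (a h : ℝ) (x₀ w : E) : Continuous (sinQuadratic a h x₀ w) := by
  unfold sinQuadratic sinPhase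
  fun_prop

theorem hasGradientAt_sinQuadratic [CompleteSpace E] (a : ℝ) {h : ℝ} (hh : h ≠ 0) (x₀ w x : E) :
    HasGradientAt (sinQuadratic a h x₀ w) (sinQuadraticGrad a h x₀ w x) x := by
  rw [hasGradientAt_iff_hasFDerivAt]
  have h1 : HasFDerivAt (fun x : E => x - x₀) (ContinuousLinearMap.id ℝ E) x :=
    (hasFDerivAt_id x).sub_const x₀
  have h2 : HasFDerivAt (sinPhase h x₀ w) (h⁻¹ • innerSL ℝ w) x := by
    have : sinPhase h x₀ w = fun y => (h⁻¹ • innerSL ℝ w) y +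
        (sinPhase h x₀ w x - (h⁻¹ • innerSL ℝ w) x) := by
      ext y
      have := sinPhase_sub h x₀ w x y
      simp only [smul_apply, innerSL_apply_apply, smul_eq_mul]
      rw [inner_sub_right] at this
      linarith
    rw [this]
    exact (h⁻¹ • innerSL ℝ w).hasFDerivAt.add_const _
  refine ((h1.norm_sq.const_mul (a / 2)).sub (h2.sin.const_mul (a * h ^ 2))).congr_fderiv ?_
  ext y
  simp only [sinQuadraticGrad, sub_apply, smul_apply,
    ContinuousLinearMap.comp_apply, innerSL_apply_apply, InnerProductSpace.toDual_apply_apply,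
    inner_sub_left, real_inner_smul_left, ContinuousLinearMap.id_apply, smul_eq_mul, nsmul_eq_mul]
  field_simp [hh]
  push_cast
  ring

/-- The phase varies at rate `‖w‖ / h`, so the factor `h ^ 2` cancels: the perturbation has
second-order error at most `2 * a * ‖w‖ ^ 2 * ‖y - x‖ ^ 2`, which `hw` fits into the slack between
curvatures `a` and `τ`. -/
theorem sinQuadratic_lower {a h τ : ℝ} (hh : 0 < h) (ha : 0 ≤ a) {w : E}
    (hw : 4 * a * ‖w‖ ^ 2 ≤ a - τ) (x₀ x y : E) :
    sinQuadratic a h x₀ w x + inner ℝ (sinQuadraticGrad a h x₀ w x) (y - x) +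
      τ / 2 * ‖x - y‖ ^ 2 ≤ sinQuadratic a h x₀ w y := by
  have h1 : ‖y - x₀‖ ^ 2 = ‖x - x₀‖ ^ 2 + 2 * inner ℝ (x - x₀) (y - x) + ‖y - x‖ ^ 2 := by
    rw [← norm_add_sq_real]
    congr 2
    abel
  have h2 := (abs_le.1 (abs_sin_sub_sin_sub_cos_mul_le (sinPhase h x₀ w x)
    (sinPhase h x₀ w y))).2
  have h3 := sinPhase_sub_sq_le h x₀ w x y
  have h4 : inner ℝ w (y - x) = h * (sinPhase h x₀ w y - sinPhase h x₀ w x) := by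
    rw [sinPhase_sub, mul_inv_cancel_left₀ hh.ne']
  rw [sinQuadratic, sinQuadratic, sinQuadraticGrad, inner_sub_left, real_inner_smul_left,
    real_inner_smul_left, h1, h4, norm_sub_rev x y]
  set s := sinPhase h x₀ w x
  set t := sinPhase h x₀ w y
  have h5 : a * h ^ 2 * (Real.sin t - Real.sin s - Real.cos s * (t - s)) ≤
      a * h ^ 2 * (2 * (h⁻¹ ^ 2 * (‖w‖ ^ 2 * ‖y - x‖ ^ 2))) := by
    gcongr
    linarith
  have h6 : a * h ^ 2 * (2 * (h⁻¹ ^ 2 * (‖w‖ ^ 2 * ‖y - x‖ ^ 2))) =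
      (4 * a * ‖w‖ ^ 2) / 2 * ‖y - x‖ ^ 2 := by
    field_simp
    ring
  have h7 : (4 * a * ‖w‖ ^ 2) / 2 * ‖y - x‖ ^ 2 ≤ (a - τ) / 2 * ‖y - x‖ ^ 2 := by gcongr
  nlinarith

theorem norm_sinQuadraticGrad_sub_le {a h L : ℝ} (hh : 0 < h) (ha : 0 ≤ a) {w : E}
    (hw : a + a * ‖w‖ ^ 2 ≤ L) (x₀ x y : E) :
    ‖sinQuadraticGrad a h x₀ w x - sinQuadraticGrad a h x₀ w y‖ ≤ L * ‖x - y‖ := by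
  have h1 : sinQuadraticGrad a h x₀ w x - sinQuadraticGrad a h x₀ w y =
      a • (x - y) - (a * h * (Real.cos (sinPhase h x₀ w x) - Real.cos (sinPhase h x₀ w y))) • w := by
    unfold sinQuadraticGrad
    module
  have h2 : |Real.cos (sinPhase h x₀ w x) - Real.cos (sinPhase h x₀ w y)| ≤
      h⁻¹ * (‖w‖ * ‖x - y‖) := by
    refine (Real.abs_cos_sub_cos_le _ _).trans ?_
    rw [sinPhase_sub, abs_mul, abs_of_pos (inv_pos.2 hh)]
    gcongr
    exact abs_real_inner_le_norm _ _
  rw [h1]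
  calc _ ≤ ‖a • (x - y)‖ + ‖(a * h * (Real.cos (sinPhase h x₀ w x) -
        Real.cos (sinPhase h x₀ w y))) • w‖ := norm_sub_le _ _
    _ ≤ a * ‖x - y‖ + a * h * (h⁻¹ * (‖w‖ * ‖x - y‖)) * ‖w‖ := by
      rw [norm_smul, norm_smul, Real.norm_eq_abs, Real.norm_eq_abs, abs_of_nonneg ha, abs_mul,
        abs_of_nonneg (by positivity : 0 ≤ a * h)]
      gcongr
    _ = (a + a * ‖w‖ ^ 2) * ‖x - y‖ := by
      field_simp
    _ ≤ L * ‖x - y‖ := by gcongr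

/-- The phase vanishes at this point, so the cosine is 1 and the two gradient terms cancel. -/
theorem sinQuadraticGrad_minimizer (a : ℝ) {h : ℝ} (hh : h ≠ 0) (x₀ w : E) :
    sinQuadraticGrad a h x₀ w (x₀ + h • w) = 0 := by
  simp [sinQuadraticGrad, sinPhase, smul_smul, hh]

theorem sinQuadratic_growth {a h τ : ℝ} (hh : 0 < h) (ha : 0 ≤ a) {w : E}
    (hw : 4 * a * ‖w‖ ^ 2 ≤ a - τ) (x₀ x : E) :
    sinQuadratic a h x₀ w (x₀ + h • w) + τ / 2 * ‖x - (x₀ + h • w)‖ ^ 2 ≤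
      sinQuadratic a h x₀ w x := by
  have := sinQuadratic_lower hh ha hw x₀ (x₀ + h • w) x
  rwa [sinQuadraticGrad_minimizer a hh.ne', inner_zero_left, add_zero, norm_sub_rev] at this

/-- Boundedness of the sine makes this uniform in `x` and `y`, even for unbounded domains. -/
theorem abs_sinQuadratic_sub_le {a : ℝ} (ha : 0 ≤ a) (h : ℝ) (x₀ w x y : E) :
    |(sinQuadratic a h x₀ w y - sinQuadratic a h x₀ w x) -
      (a / 2 * ‖y - x₀‖ ^ 2 - a / 2 * ‖x - x₀‖ ^ 2)| ≤ 2 * a * h ^ 2 := by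
  have e : (sinQuadratic a h x₀ w y - sinQuadratic a h x₀ w x) -
      (a / 2 * ‖y - x₀‖ ^ 2 - a / 2 * ‖x - x₀‖ ^ 2) =
      a * h ^ 2 * (Real.sin (sinPhase h x₀ w x) - Real.sin (sinPhase h x₀ w y)) := by
    unfold sinQuadratic
    ring
  rw [e, abs_mul, abs_of_nonneg (by positivity : 0 ≤ a * h ^ 2)]
  have : |Real.sin (sinPhase h x₀ w x) - Real.sin (sinPhase h x₀ w y)| ≤ 2 := by
    rw [abs_le]
    constructor <;> linarith [Real.sin_le_one (sinPhase h x₀ w x),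
      Real.sin_le_one (sinPhase h x₀ w y), Real.neg_one_le_sin (sinPhase h x₀ w x),
      Real.neg_one_le_sin (sinPhase h x₀ w y)]
  nlinarith [mul_le_mul_of_nonneg_left this (by positivity : 0 ≤ a * h ^ 2)]

end sinQuadratic

/-! ### Hard instances for noiseless and noisy comparisons -/

theorem isStronglyConvexSmooth_sinQuadratic {n : ℕ} {τ L a h : ℝ} (hτ : 0 ≤ τ) (hh : 0 < h)
    (ha : 0 ≤ a) {B : Set (EuclideanSpace ℝ (Fin n))} {x₀ w : EuclideanSpace ℝ (Fin n)}
    (hw : 4 * a * ‖w‖ ^ 2 ≤ a - τ) (hw' : a + a * ‖w‖ ^ 2 ≤ L) (hB : x₀ + h • w ∈ B) :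
    IsStronglyConvexSmooth τ L B (sinQuadratic a h x₀ w) := by
  refine ⟨sinQuadraticGrad a h x₀ w, fun x _ => ?_, fun x _ y _ => sinQuadratic_lower hh ha hw _ _ _,
    fun x _ y _ => norm_sinQuadraticGrad_sub_le hh ha hw' _ _ _, x₀ + h • w, hB, fun x _ => ?_⟩
  · exact (hasGradientAt_sinQuadratic a hh.ne' x₀ w x).hasFDerivAt.hasFDerivWithinAt
  · exact (le_add_of_nonneg_right (by positivity)).trans (sinQuadratic_growth hh ha hw x₀ x)

theorem measurable_increment {n : ℕ} {B : Set (EuclideanSpace ℝ (Fin n))}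
    {f : EuclideanSpace ℝ (Fin n) → ℝ} (hf : Continuous f) :
    Measurable fun z : B × B => f z.2 - f z.1 := by
  have := hf.measurable
  fun_prop

/-- Noiseless comparisons of quadratics reveal one bit per query. -/
theorem le_comparisonMinimaxRisk_noiseless {n : ℕ} (hn : 0 < n) (s₀ : Bool) {κ μ δ₀ τ L R : ℝ}
    (hδ₀ : δ₀ ≤ 1 / 2) (hτ : 0 ≤ τ) (hτL : τ ≤ L) {B : Set (EuclideanSpace ℝ (Fin n))}
    {x₀ : EuclideanSpace ℝ (Fin n)} (hR : 0 < R) (hball : Metric.ball x₀ R ⊆ B) {T : ℕ} {δ : ℝ}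
    (hδ : 0 ≤ δ) (h : 2 ^ T * (δ / R) ^ n ≤ 1 / 4) :
    ENNReal.ofReal (τ / 4 * δ ^ 2) ≤ comparisonMinimaxRisk s₀ κ μ δ₀ τ L B T := by
  let Q : Kernel (B × B) Bool := biasedKernel (fun _ => true) measurable_const (fun _ => 0)
    measurable_const
  have : IsMarkovKernel Q := isMarkovKernel_biasedKernel (by norm_num)
  refine le_comparisonMinimaxRisk hn s₀ hτ hR hδ zero_le_two hball Q (fun v hv => ?_) h
  -- With `w = 0` the perturbation vanishes, leaving the quadratic of curvature `τ` centred at `v`.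
  refine ⟨sinQuadratic τ 1 v 0, ?_, fun x _ => ?_, biasedKernel _
    ((measurable_boolSign s₀).comp (measurable_increment (continuous_sinQuadratic τ 1 v 0)))
    (fun _ => 1 / 2) measurable_const, ⟨isMarkovKernel_biasedKernel (by norm_num), ?_⟩, fun z => ?_⟩
  · exact isStronglyConvexSmooth_sinQuadratic hτ one_pos hτ (by simp) (by simpa using hτL)
      (by simpa using hball hv)
  · simpa using sinQuadratic_growth one_pos hτ (w := 0) (τ := τ) (by simp) v x
  · intro x y
    refine le_trans ?_ (biasedKernel_real_singleton (x, y) (by norm_num)).ge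
    gcongr
    exact (min_le_left _ _).trans hδ₀
  · have := secondMomentBound_biasedKernel (s := boolSign s₀ ∘ fun z : B × B =>
        sinQuadratic τ 1 v 0 z.2 - sinQuadratic τ 1 v 0 z.1) (hs := (measurable_boolSign s₀).comp
        (measurable_increment (continuous_sinQuadratic τ 1 v 0))) (e := fun _ => 1 / 2)
        (he := measurable_const) (s' := fun _ => true) (hs' := measurable_const)
        (e' := fun _ => 0) (he' := measurable_const) z (by norm_num) rfl (η := 1 / 2) le_rfl
    norm_num at this
    simpa using this

/-- Comparisons that are exact outside of the noise level `2 a h²` and biased by `η` within it. -/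
theorem le_comparisonMinimaxRisk_noisy {n : ℕ} (hn : 0 < n) (s₀ : Bool)
    {κ μ δ₀ τ L a h ρ η : ℝ} (hκ : 1 ≤ κ) (hμ : 0 ≤ μ) (hδ₀ : 0 ≤ δ₀) (hδ₀' : δ₀ ≤ 1 / 2)
    (hτ : 0 ≤ τ) (ha : 0 ≤ a) (hh : 0 < h) (hρ : 0 < ρ) (hρτ : 4 * a * ρ ^ 2 ≤ a - τ)
    (hρL : a + a * ρ ^ 2 ≤ L) (hη : μ * (4 * a * h ^ 2) ^ (κ - 1) ≤ η)
    {B : Set (EuclideanSpace ℝ (Fin n))} {x₀ : EuclideanSpace ℝ (Fin n)}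
    (hball : Metric.ball x₀ (h * ρ) ⊆ B) {T : ℕ} {δ : ℝ}
    (hδ : 0 ≤ δ) (hT : (1 + 4 * η ^ 2) ^ T * (δ / (h * ρ)) ^ n ≤ 1 / 4) :
    ENNReal.ofReal (τ / 4 * δ ^ 2) ≤ comparisonMinimaxRisk s₀ κ μ δ₀ τ L B T := by
  set D : B × B → ℝ := fun z => a / 2 * ‖(z.2 : EuclideanSpace ℝ (Fin n)) - x₀‖ ^ 2 -
    a / 2 * ‖(z.1 : EuclideanSpace ℝ (Fin n)) - x₀‖ ^ 2 with hD
  have hDm : Measurable D := measurable_increment (f := fun x => a / 2 * ‖x - x₀‖ ^ 2)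
    (by fun_prop)
  have hfar : MeasurableSet {z | 2 * a * h ^ 2 < |D z|} :=
    measurableSet_lt measurable_const (measurable_abs.comp hDm)
  -- The threshold is the largest shift of an increment by the perturbation; above it the sign is
  -- that of `D`, whatever `v` is.
  let e : ℝ → B × B → ℝ := fun t z => if 2 * a * h ^ 2 < |D z| then 1 / 2 else t
  have hem : ∀ t, Measurable (e t) := fun t => Measurable.ite hfar measurable_const measurable_const
  have hη0 : 0 ≤ μ * (4 * a * h ^ 2) ^ (κ - 1) := by positivity
  -- Capping at `δ₀` keeps the bias at most 1/2 and still meets the oracle condition.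
  set b := min δ₀ η with hb
  have hb0 : 0 ≤ b := le_min hδ₀ (hη0.trans hη)
  have hb2 : b ≤ 1 / 2 := (min_le_left _ _).trans hδ₀'
  have hbη : b ≤ η := min_le_right _ _
  have hebound : ∀ t, 0 ≤ t → t ≤ 1 / 2 → ∀ z, |e t z| ≤ 1 / 2 := by
    intro t h0 h1 z
    simp only [e]
    split_ifs
    · norm_num
    · rwa [abs_of_nonneg h0]
  let Q : Kernel (B × B) Bool := biasedKernel _ ((measurable_boolSign s₀).comp hDm) (e 0) (hem 0)
  have : IsMarkovKernel Q := isMarkovKernel_biasedKernel (hebound 0 le_rfl (by norm_num))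
  refine le_comparisonMinimaxRisk hn s₀ hτ (by positivity) hδ (by positivity) hball Q
    (fun v hv => ?_) hT
  obtain ⟨w, rfl⟩ : ∃ w, v = x₀ + h • w := ⟨h⁻¹ • (v - x₀), by simp [smul_smul, hh.ne']⟩
  have hwρ : ‖w‖ ≤ ρ := by
    rw [Metric.mem_ball, dist_eq_norm, add_sub_cancel_left, norm_smul, Real.norm_eq_abs,
      abs_of_pos hh] at hv
    exact (lt_of_mul_lt_mul_left hv hh.le).le
  have hw2 : a * ‖w‖ ^ 2 ≤ a * ρ ^ 2 := by gcongr
  have hw4 : 4 * a * ‖w‖ ^ 2 ≤ a - τ := by linarith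
  set f := sinQuadratic a h x₀ w with hf
  have hfm := (measurable_boolSign s₀).comp (measurable_increment (B := B)
    (continuous_sinQuadratic a h x₀ w))
  refine ⟨f, isStronglyConvexSmooth_sinQuadratic hτ hh ha hw4 (by linarith) (hball hv),
    fun x _ => sinQuadratic_growth hh ha hw4 x₀ x, biasedKernel _ hfm (e b) (hem b),
    ⟨isMarkovKernel_biasedKernel (hebound b hb0 hb2), fun x y => ?_⟩, fun z => ?_⟩
  · refine le_trans ?_ (biasedKernel_real_singleton (x, y) (hebound b hb0 hb2 _)).ge
    gcongr
    simp only [e]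
    split_ifs with hcase
    · exact (min_le_left _ _).trans hδ₀'
    · refine min_le_min le_rfl (le_trans ?_ hη)
      have h1 := abs_sinQuadratic_sub_le ha h x₀ w (x : EuclideanSpace ℝ (Fin n)) y
      have h2 : |f y - f x| ≤ 4 * a * h ^ 2 := by
        have h3 := abs_sub_abs_le_abs_sub (f y - f x) (D (x, y))
        have h4 : |f y - f x - D (x, y)| ≤ 2 * a * h ^ 2 := h1
        linarith
      gcongr
  · by_cases hcase : 2 * a * h ^ 2 < |D z|
    · have heq : biasedKernel _ hfm (e b) (hem b) z = Q z := by
        refine biasedKernel_congr (boolSign_eq_of_abs_sub_lt ?_) ?_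
        · exact (abs_sinQuadratic_sub_le ha h x₀ w (z.1 : EuclideanSpace ℝ (Fin n)) z.2).trans_lt
            hcase
        · simp [e, hcase]
      rw [heq]
      intro g hg
      refine (SecondMomentBound.refl (Q z) g hg).trans ?_
      gcongr
      rw [ENNReal.one_le_ofReal]
      nlinarith [sq_nonneg η]
    · refine secondMomentBound_biasedKernel z (hebound b hb0 hb2 z) (by simp [e, hcase]) ?_
      simp only [e, hcase, if_false]
      gcongr

/-- The noise level at which `T` queries give information of order `n`. -/
theorem exists_noise_scale {κ μ a : ℝ} (hκ : 1 < κ) (hμ : 0 < μ) (ha : 0 < a) :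
    ∃ c : ℝ, 0 < c ∧ ∀ u : ℝ, 0 < u →
      4 * (μ * (4 * a * (√(c * u ^ (1 / (2 * (κ - 1))))) ^ 2) ^ (κ - 1)) ^ 2 = u := by
  have hκ' : 0 < κ - 1 := by linarith
  -- This `c` solves `4 * μ ^ 2 * (4 * a * c) ^ (2 * (κ - 1)) = 1`.
  refine ⟨(4 * a)⁻¹ * ((4 * μ ^ 2)⁻¹) ^ (1 / (2 * (κ - 1))), by positivity, fun u hu => ?_⟩
  rw [Real.sq_sqrt (by positivity), ← mul_assoc, ← mul_assoc, mul_inv_cancel₀ (by positivity),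
    one_mul, ← Real.mul_rpow (by positivity) hu.le, ← Real.rpow_mul (by positivity), mul_pow,
    ← Real.rpow_natCast, ← Real.rpow_natCast (_ ^ _), ← Real.rpow_mul (by positivity)]
  have : 1 / (2 * (κ - 1)) * (κ - 1) * ((2 : ℕ) : ℝ) = 1 := by
    push_cast
    field_simp
  rw [this, Real.rpow_one]
  push_cast
  rw [Real.rpow_two]
  field_simp

theorem one_add_pow_mul_inv_eight_pow_le {n T : ℕ} (hn : 2 ≤ n) (hT : 0 < T) :
    (1 + (n : ℝ) / T) ^ T * (1 / 8) ^ n ≤ 1 / 4 := by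
  have h1 : (1 + (n : ℝ) / T) ^ T ≤ 4 ^ n := by
    calc (1 + (n : ℝ) / T) ^ T ≤ Real.exp (n / T) ^ T := by
          gcongr
          linarith [Real.add_one_le_exp ((n : ℝ) / T)]
      _ = Real.exp 1 ^ n := by
        rw [← Real.exp_nat_mul, ← Real.exp_nat_mul]
        congr 1
        field_simp
      _ ≤ 4 ^ n := by
        gcongr
        linarith [Real.exp_one_lt_d9]
  calc (1 + (n : ℝ) / T) ^ T * (1 / 8) ^ n ≤ 4 ^ n * (1 / 8) ^ n := by gcongr
    _ = (1 / 2) ^ n := by rw [← mul_pow]; norm_num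
    _ ≤ (1 / 2) ^ 2 := pow_le_pow_of_le_one (by norm_num) (by norm_num) hn
    _ = 1 / 4 := by norm_num

end

/-! ### Choice of the parameters -/

theorem theorem1 (s₀ : Bool) (κ μ δ₀ τ L r : ℝ)
    (hκ : 1 ≤ κ) (hμ : 0 < μ) (hδ₀ : 0 < δ₀) (hδ₀' : δ₀ ≤ 1 / 2)
    (hτ : 0 < τ) (hτL : τ ≤ L) (hr : 0 < r) :
    (κ = 1 → ∃ c₁ c₂ : ℝ, 0 < c₁ ∧ 0 < c₂ ∧
      ∀ n : ℕ, 8 ≤ n → ∀ B : Set (EuclideanSpace ℝ (Fin n)), Convex ℝ B →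
        (∃ x₀, Metric.ball x₀ r ⊆ B) →
        ∃ T₀ : ℕ, ∀ T : ℕ, T₀ ≤ T →
          ENNReal.ofReal (c₁ * Real.exp (-c₂ * ((T : ℝ) / n))) ≤
            comparisonMinimaxRisk s₀ κ μ δ₀ τ L B T) ∧
    (1 < κ → τ < L → ∃ c₃ : ℝ, 0 < c₃ ∧
      ∀ n : ℕ, 8 ≤ n → ∀ B : Set (EuclideanSpace ℝ (Fin n)), Convex ℝ B →
        (∃ x₀, Metric.ball x₀ r ⊆ B) →
        ∃ T₀ : ℕ, ∀ T : ℕ, T₀ ≤ T →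
          ENNReal.ofReal (c₃ * ((n : ℝ) / T) ^ (1 / (2 * (κ - 1)))) ≤
            comparisonMinimaxRisk s₀ κ μ δ₀ τ L B T) := by
  refine ⟨fun _ => ⟨τ / 16 * r ^ 2, 2 * Real.log 2, by positivity,
    mul_pos two_pos (Real.log_pos one_lt_two), ?_⟩, fun hκ1 hτL' => ?_⟩
  · rintro n hn B - ⟨x₀, hball⟩
    refine ⟨0, fun T _ => ?_⟩
    have hn0 : (0 : ℝ) < n := by exact_mod_cast (by omega : 0 < n)
    -- This is `r / 2 * 2 ^ (-T / n)`: the power of two cancels `K ^ T`, and `(1 / 2) ^ n` remains.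
    set δ := r * (1 / 2 * Real.exp (-(Real.log 2 * (T / n)))) with hδ
    have h := le_comparisonMinimaxRisk_noiseless (by omega : 0 < n) s₀ (κ := κ) (μ := μ) hδ₀' hτ.le
      hτL hr hball (T := T) (δ := δ) (by positivity) ?_
    · refine le_trans (le_of_eq ?_) h
      congr 1
      rw [hδ, mul_pow, mul_pow, ← Real.exp_nat_mul]
      push_cast
      ring_nf
    · rw [hδ, mul_div_cancel_left₀ _ hr.ne', mul_pow, ← Real.exp_nat_mul]
      have e1 : (n : ℝ) * -(Real.log 2 * (T / n)) = -(T * Real.log 2) := by field_simp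
      rw [e1, Real.exp_neg, Real.exp_nat_mul, Real.exp_log two_pos]
      calc (2 : ℝ) ^ T * ((1 / 2) ^ n * (2 ^ T)⁻¹) = (1 / 2) ^ n := by field_simp
        _ ≤ (1 / 2) ^ 2 := pow_le_pow_of_le_one (by norm_num) (by norm_num) (by omega)
        _ = 1 / 4 := by norm_num
  · set a := (τ + L) / 2 with ha_def
    have ha : 0 < a := by linarith
    obtain ⟨c, hc, hscale⟩ := exists_noise_scale hκ1 hμ ha
    -- With `a` the midpoint of `τ` and `L`, this gives `4 * a * ρ ^ 2 = a - τ`, the largest `ρ`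
    -- allowed by strong convexity; smoothness then has room to spare.
    set ρ := √((L - τ) / (8 * a)) with hρ_def
    have hρpos : 0 < ρ := Real.sqrt_pos.2 (div_pos (by linarith) (by positivity))
    have hρ2 : a * ρ ^ 2 = (L - τ) / 8 := by
      rw [hρ_def, Real.sq_sqrt (div_nonneg (by linarith) (by positivity))]
      field_simp
    -- The factor is `1 / 4 * (1 / 8) ^ 2`, from `δ = h * ρ / 8`.
    refine ⟨τ / 256 * ρ ^ 2 * c, by positivity, ?_⟩
    rintro n hn B - ⟨x₀, hball⟩
    have hn0 : (0 : ℝ) < n := by exact_mod_cast (by omega : 0 < n)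
    -- The minimizers fill a ball of radius `h * ρ`, which must fit into the given ball; this is
    -- where `T` has to be large.
    have hlim : Filter.Tendsto
        (fun T : ℕ => √(c * ((n : ℝ) / T) ^ (1 / (2 * (κ - 1)))) * ρ) Filter.atTop (nhds 0) := by
      have h1 := tendsto_const_div_atTop_nhds_zero_nat (n : ℝ)
      have hp : 0 < 1 / (2 * (κ - 1)) := by
        have : 0 < κ - 1 := by linarith
        positivity
      have h2 := ((h1.rpow_const (Or.inr hp.le)).const_mul c).sqrt.mul_const ρ
      rwa [Real.zero_rpow hp.ne', mul_zero, Real.sqrt_zero, zero_mul] at h2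
    obtain ⟨T₀, hT₀⟩ := Filter.eventually_atTop.1 (hlim.eventually (gt_mem_nhds hr))
    refine ⟨max T₀ 1, fun T hT => ?_⟩
    have hT1 : 0 < T := (le_max_right _ _).trans hT
    have hT1' : (0 : ℝ) < T := by exact_mod_cast hT1
    have hu : 0 < (n : ℝ) / T := by positivity
    have hhr := hT₀ T ((le_max_left _ _).trans hT)
    have hsc := hscale _ hu
    set h := √(c * ((n : ℝ) / T) ^ (1 / (2 * (κ - 1)))) with hh_def
    have hh : 0 < h := Real.sqrt_pos.2 (by positivity)
    have hh2 : h ^ 2 = c * ((n : ℝ) / T) ^ (1 / (2 * (κ - 1))) := Real.sq_sqrt (by positivity)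
    have key := le_comparisonMinimaxRisk_noisy (by omega : 0 < n) s₀ (L := L) hκ hμ.le hδ₀.le hδ₀'
      hτ.le ha.le hh hρpos (by linarith) (by linarith) le_rfl
      ((Metric.ball_subset_ball hhr.le).trans hball) (T := T) (δ := h * ρ * (1 / 8))
      (by positivity) ?_
    · refine le_trans (le_of_eq ?_) key
      congr 1
      rw [mul_assoc _ c, ← hh2]
      ring
    · rw [hsc, mul_div_cancel_left₀ _ (by positivity)]
      exact one_add_pow_mul_inv_eight_pow_le (by omega) hT1
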